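/- Let $L$ be a finite-dimensional semisimple Lie algebra over $\mathbb{C}$ with a Cartan subalgebra $H$. Call an $L$-module $V$ (a priori of arbitrary dimension) integrable with respect to $H$ if: (1) $V=\bigoplus_{\lambda\in H^*}V_\lambda$, where $V_\lambda=\{v\in V \mid h.v=\lambda(h)v \text{ for all } h\in H\}$; (2) $\dim V_\lambda<\infty$ for every $\lambda\in H^*$; (3) every root vector acts locally nilpotently on $V$: for every $0\neq\alpha\in H^*$, every $x\in L_\alpha=\{x\in L\mid [h,x]=\alpha(h)x \text{ for all } h\in H\}$ and every $v\in V$, there is $m\in\mathbb{N}$ such that $x^m.v=0$. Then every $L$-module that is integrable with respect to $H$ is finite-dimensional. -/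

import Mathlib

open Classical in
/-- `V` is an integrable `L`-module with respect to the subalgebra `H`. Here
`LieModule.weightSpace V l = {v | ∀ h : H, h.v = l(h) v}` for a linear form `l` on `H`, and
`LieModule.weightSpace L α = {x | ∀ h : H, [h, x] = α(h) x}` is the root space of `L` for `α`. -/
structure IsIntegrableModule {L : Type*} [LieRing L] [LieAlgebra ℂ L] (H : LieSubalgebra ℂ L)
    (V : Type*) [AddCommGroup V] [Module ℂ V] [LieRingModule L V]
    [LieModule ℂ L V] : Prop where
  /-- `V` is the direct sum of its weight spaces. -/
  isInternal_weightSpace : DirectSum.IsInternal fun l : Module.Dual ℂ H =>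
    (LieModule.weightSpace V (l : H → ℂ)).toSubmodule
  /-- All weight spaces are finite-dimensional. -/
  finite_weightSpace : ∀ l : Module.Dual ℂ H,
    FiniteDimensional ℂ (LieModule.weightSpace V (l : H → ℂ))
  /-- All root vectors act locally nilpotently on `V`. -/
  locallyNilpotent : ∀ α : Module.Dual ℂ H, α ≠ 0 →
    ∀ x ∈ LieModule.weightSpace L (α : H → ℂ), ∀ v : V,
      ∃ m : ℕ, (LieModule.toEnd ℂ L V x ^ m) v = 0

/-! The integral weights pairing with every coroot to -1, 0 or 1 are finite in number, so their
weight spaces span a finite-dimensional `U`. As `L` is spanned by finitely many locally finite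
elements, a PBW reordering argument (`exists_finiteDimensional_lieSubmodule`) puts `U` inside a
finite-dimensional submodule `M`. Every other weight `χ` pairs to some `m ≥ 2` with the coroot of a
root `α`, and `χ - α` is shorter for the root form. By induction `V_(χ - α)` lies in `M`. By `sl₂`
theory `e ^ m * f ^ m` is injective on the finite-dimensional `V_χ`, hence onto, and it factors
through `V_(χ - α)`; so `V_χ` lies in `M` (`mem_of_lie_f_mem`). Thus `M = V`. -/

namespace LieModule

/-! ### Locally finite actions and PBW reordering -/

section LocallyFinite

variable {K L V ι : Type*} [Field K] [LieRing L] [LieAlgebra K L]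
  [AddCommGroup V] [Module K V] [LieRingModule L V] [LieModule K L V]

/-- An element of a Lie algebra acts locally finitely on a module if every vector lies in a
finite-dimensional subspace stable under it. -/
def IsLocallyFiniteElement (K : Type*) {L : Type*} (V : Type*) [Field K] [LieRing L]
    [AddCommGroup V] [Module K V] [LieRingModule L V] (x : L) : Prop :=
  ∀ v : V, ∃ W : Submodule K V, FiniteDimensional K W ∧ v ∈ W ∧ ∀ w ∈ W, ⁅x, w⁆ ∈ W

lemma IsLocallyFiniteElement.exists_le {x : L} (hx : IsLocallyFiniteElement K V x)
    (U : Submodule K V) [FiniteDimensional K U] :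
    ∃ W : Submodule K V, FiniteDimensional K W ∧ U ≤ W ∧ ∀ w ∈ W, ⁅x, w⁆ ∈ W := by
  obtain ⟨s, hs⟩ := (Submodule.fg_iff_finiteDimensional U).2 inferInstance
  choose W hfin hmem hlie using hx
  refine ⟨⨆ v : s, W v, inferInstance, ?_, ?_⟩
  · rw [← hs, Submodule.span_le]
    exact fun v hv ↦ le_iSup (fun v : s ↦ W v) ⟨v, hv⟩ (hmem v)
  · suffices (⨆ v : s, W v) ≤ (⨆ v : s, W v).comap (toEnd K L V x) from this
    exact iSup_le fun v w hw ↦ le_iSup (fun v : s ↦ W v) v (hlie v w hw)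

/-- The iterated action of a list of elements of a Lie algebra. -/
def word (x : ι → L) (l : List ι) (v : V) : V := l.foldr (fun i w ↦ ⁅x i, w⁆) v

@[simp] lemma word_nil (x : ι → L) (v : V) : word x [] v = v := rfl

@[simp] lemma word_cons (x : ι → L) (i : ι) (l : List ι) (v : V) :
    word x (i :: l) v = ⁅x i, word x l v⁆ := rfl

/-- The span of the words of length less than `n` applied to the vectors of `U`. -/
def wordSpan (x : ι → L) (U : Submodule K V) (n : ℕ) : Submodule K V :=
  Submodule.span K {w | ∃ l : List ι, l.length < n ∧ ∃ u ∈ U, word x l u = w}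

omit [LieAlgebra K L] [LieModule K L V] in
lemma word_mem_wordSpan (x : ι → L) {U : Submodule K V} {n : ℕ} {l : List ι} (hl : l.length < n)
    {u : V} (hu : u ∈ U) : word x l u ∈ wordSpan x U n :=
  Submodule.subset_span ⟨l, hl, u, hu, rfl⟩

lemma lie_mem_wordSpan_succ (x : ι → L) {U : Submodule K V} {n : ℕ} (i : ι) {w : V}
    (hw : w ∈ wordSpan x U n) : ⁅x i, w⁆ ∈ wordSpan x U (n + 1) := by
  suffices wordSpan x U n ≤ (wordSpan x U (n + 1)).comap (toEnd K L V (x i)) from this hw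
  refine Submodule.span_le.2 ?_
  rintro _ ⟨l, hl, u, hu, rfl⟩
  exact word_mem_wordSpan x (l := i :: l) (by simpa using hl) hu

lemma lie_word_mem_wordSpan {x : ι → L} (hx : Submodule.span K (Set.range x) = ⊤)
    {U : Submodule K V} (z : L) (l : List ι) {u : V} (hu : u ∈ U) :
    ⁅z, word x l u⁆ ∈ wordSpan x U (l.length + 2) := by
  have hz : z ∈ Submodule.span K (Set.range x) := hx ▸ Submodule.mem_top
  induction hz using Submodule.span_induction with
  | mem z hz =>
    obtain ⟨i, rfl⟩ := hz
    exact word_mem_wordSpan x (l := i :: l) (by simp) hu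
  | zero => simp
  | add y z _ _ hy hz => rw [add_lie]; exact add_mem hy hz
  | smul c z _ hz => rw [smul_lie]; exact Submodule.smul_mem _ c hz

/-- Swapping two neighbouring letters costs their bracket, a combination of single letters, hence
only shorter words. -/
lemma word_sub_word_mem_wordSpan {x : ι → L} (hx : Submodule.span K (Set.range x) = ⊤)
    {U : Submodule K V} {l l' : List ι} (h : l.Perm l') {u : V} (hu : u ∈ U) :
    word x l u - word x l' u ∈ wordSpan x U l.length := by
  induction h with
  | nil => simp
  | cons i _ ih => simpa [lie_sub] using lie_mem_wordSpan_succ x i ih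
  | swap i j l =>
    rw [word_cons, word_cons, word_cons, word_cons, ← lie_lie]
    exact lie_word_mem_wordSpan hx _ l hu
  | trans h _ ih ih' =>
    rw [← h.length_eq] at ih'
    simpa using add_mem ih ih'

/-- A new smallest letter stands leftmost in a sorted word, so it acts last: enlarging the previous
space to one stable under it suffices. -/
lemma exists_sorted_word_mem [LinearOrder ι] (x : ι → L)
    (hfin : ∀ i, IsLocallyFiniteElement K V (x i)) (U : Submodule K V) [FiniteDimensional K U]
    (s : Finset ι) :
    ∃ W : Submodule K V, FiniteDimensional K W ∧
      ∀ l : List ι, l.Pairwise (· ≤ ·) → (∀ i ∈ l, i ∈ s) → ∀ u ∈ U, word x l u ∈ W := by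
  induction s using Finset.induction_on_min with
  | empty =>
    refine ⟨U, inferInstance, fun l _ hl u hu ↦ ?_⟩
    obtain rfl : l = [] := List.eq_nil_iff_forall_not_mem.2 fun i hi ↦ by simpa using hl i hi
    exact hu
  | insert a s ha ih =>
    obtain ⟨W, _, hW⟩ := ih
    obtain ⟨W', hW'fin, hle, hlie⟩ := (hfin a).exists_le W
    refine ⟨W', hW'fin, fun l ↦ ?_⟩
    induction l with
    | nil => exact fun _ _ u hu ↦ hle (hW [] List.Pairwise.nil (by simp) u hu)
    | cons i l ihl =>
      intro hsort hl u hu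
      obtain rfl | hi := Finset.mem_insert.1 (hl i (by simp))
      · exact hlie _ (ihl hsort.of_cons (fun j hj ↦ hl j (by simp [hj])) u hu)
      · refine hle (hW _ hsort (fun j hj ↦ ?_) u hu)
        refine Finset.mem_of_mem_insert_of_ne (hl j hj) (ne_of_gt ?_)
        obtain rfl | hj := List.mem_cons.1 hj
        · exact ha _ hi
        · exact (ha i hi).trans_le (List.rel_of_pairwise_cons hsort hj)

/-- If a Lie algebra is spanned by finitely many elements acting locally finitely on a module, then
every finite-dimensional subspace generates a finite-dimensional submodule. -/
lemma exists_finiteDimensional_lieSubmodule [LinearOrder ι] [Fintype ι] {x : ι → L}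
    (hx : Submodule.span K (Set.range x) = ⊤) (hfin : ∀ i, IsLocallyFiniteElement K V (x i))
    (U : Submodule K V) [FiniteDimensional K U] :
    ∃ M : LieSubmodule K L V, FiniteDimensional K M ∧ U ≤ M.toSubmodule := by
  obtain ⟨W, _, hW⟩ := exists_sorted_word_mem x hfin U Finset.univ
  have hle (n : ℕ) : wordSpan x U n ≤ W := by
    induction n with
    | zero => exact Submodule.span_le.2 (by rintro _ ⟨l, hl, -⟩; simp at hl)
    | succ n ih =>
      refine Submodule.span_le.2 ?_
      rintro _ ⟨l, hl, u, hu, rfl⟩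
      have hsort := hW (l.insertionSort (· ≤ ·)) (List.pairwise_insertionSort _ l) (by simp) u hu
      have hsub := word_sub_word_mem_wordSpan hx (List.perm_insertionSort (· ≤ ·) l).symm hu
      have hmono : wordSpan x U l.length ≤ wordSpan x U n :=
        Submodule.span_mono fun _ ⟨t, ht, h⟩ ↦ ⟨t, by omega, h⟩
      simpa using add_mem (ih (hmono hsub)) hsort
  let M : Submodule K V := Submodule.span K {w | ∃ l : List ι, ∃ u ∈ U, word x l u = w}
  have hMW : M ≤ W := by
    refine Submodule.span_le.2 ?_
    rintro _ ⟨l, u, hu, rfl⟩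
    exact hle _ (word_mem_wordSpan x (Nat.lt_succ_self _) hu)
  refine ⟨{ M with lie_mem := ?_ }, Submodule.finiteDimensional_of_le hMW,
    fun u hu ↦ Submodule.subset_span ⟨[], u, hu, rfl⟩⟩
  intro z w hw
  have hz : z ∈ Submodule.span K (Set.range x) := hx ▸ Submodule.mem_top
  induction hz using Submodule.span_induction with
  | mem z hz =>
    obtain ⟨i, rfl⟩ := hz
    suffices M ≤ M.comap (toEnd K L V (x i)) from this hw
    refine Submodule.span_le.2 ?_
    rintro _ ⟨l, u, hu, rfl⟩
    exact Submodule.subset_span ⟨i :: l, u, hu, rfl⟩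
  | zero => rw [zero_lie]; exact M.zero_mem
  | add y z _ _ hy hz => rw [add_lie]; exact M.add_mem hy hz
  | smul c z _ hz => rw [smul_lie]; exact M.smul_mem c hz

lemma isLocallyFiniteElement_of_pow_eq_zero {x : L}
    (hx : ∀ v : V, ∃ n : ℕ, (toEnd K L V x ^ n) v = 0) : IsLocallyFiniteElement K V x := by
  intro v
  obtain ⟨n, hn⟩ := hx v
  -- `n + 1` powers rather than `n`, so that `v` itself is a generator even when `n = 0`.
  refine ⟨Submodule.span K (Set.range fun i : Fin (n + 1) ↦ (toEnd K L V x ^ (i : ℕ)) v),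
    FiniteDimensional.span_of_finite K (Set.finite_range _),
    Submodule.subset_span ⟨0, by simp⟩, fun w hw ↦ ?_⟩
  suffices Submodule.span K (Set.range fun i : Fin (n + 1) ↦ (toEnd K L V x ^ (i : ℕ)) v) ≤
    (Submodule.span K (Set.range fun i : Fin (n + 1) ↦ (toEnd K L V x ^ (i : ℕ)) v)).comap
      (toEnd K L V x) from this hw
  refine Submodule.span_le.2 ?_
  rintro _ ⟨i, rfl⟩
  rw [SetLike.mem_coe, Submodule.mem_comap, ← Module.End.mul_apply, ← pow_succ']
  obtain hi | hi := lt_or_eq_of_le (Nat.succ_le_of_lt i.2)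
  · exact Submodule.subset_span ⟨⟨i + 1, hi⟩, rfl⟩
  · have : (i : ℕ) + 1 = n + 1 := hi
    rw [this, pow_succ', Module.End.mul_apply, hn, map_zero]
    exact zero_mem _

lemma isLocallyFiniteElement_of_iSup_eq_top {κ : Type*} {x : L} (A : κ → Submodule K V)
    (hA : ⨆ k, A k = ⊤) [∀ k, FiniteDimensional K (A k)] (hx : ∀ k, ∀ v ∈ A k, ⁅x, v⁆ ∈ A k) :
    IsLocallyFiniteElement K V x := by
  intro v
  have hv : v ∈ ⨆ k, A k := hA ▸ Submodule.mem_top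
  obtain ⟨s, hs⟩ := (Submodule.mem_iSup_iff_exists_finset).1 hv
  rw [iSup_subtype'] at hs
  refine ⟨_, inferInstance, hs, fun w hw ↦ ?_⟩
  suffices (⨆ k : s, A k) ≤ (⨆ k : s, A k).comap (toEnd K L V x) from this hw
  exact iSup_le fun k w hw ↦ le_iSup (fun k : s ↦ A k) k (hx k w hw)

end LocallyFinite

end LieModule

/-! ### Locally nilpotent `sl₂` actions -/

namespace IsSl2Triple

open LieModule

section

variable {K L V : Type*} [Field K] [CharZero K] [LieRing L] [LieAlgebra K L]
  [AddCommGroup V] [Module K V] [LieRingModule L V] [LieModule K L V] {h e f : L}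

omit [CharZero K] in
lemma lie_h_pow_toEnd_f_of_eq_smul (t : IsSl2Triple h e f) {v : V} {μ : K} (hv : ⁅h, v⁆ = μ • v)
    (n : ℕ) : ⁅h, (toEnd K L V f ^ n) v⁆ = (μ - 2 * n) • (toEnd K L V f ^ n) v := by
  have := t.symm.lie_h_pow_toEnd_e (R := K) (m := v) (μ := -μ) (by simp [hv]) n
  rw [neg_lie, neg_eq_iff_eq_neg, ← neg_smul] at this
  rw [this]
  congr 1
  ring

omit [CharZero K] in
lemma pow_succ_toEnd_f_lie_e (t : IsSl2Triple h e f) {v : V} {μ : K} (hv : ⁅h, v⁆ = μ • v)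
    (n : ℕ) : (toEnd K L V f ^ (n + 1)) ⁅e, v⁆ =
      ⁅e, (toEnd K L V f ^ (n + 1)) v⁆ - ((n + 1) * (μ - n)) • (toEnd K L V f ^ n) v := by
  have hfe (u : V) : ⁅f, ⁅e, u⁆⁆ = ⁅e, ⁅f, u⁆⁆ - ⁅h, u⁆ := by
    rw [← t.lie_e_f, lie_lie]; abel
  have hpow (k : ℕ) (u : V) : (toEnd K L V f ^ (k + 1)) u = ⁅f, (toEnd K L V f ^ k) u⁆ := by
    rw [pow_succ', Module.End.mul_apply, toEnd_apply_apply]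
  induction n with
  | zero => simp [hfe, hv]
  | succ n ih =>
    rw [hpow, ih, lie_sub, lie_smul, hfe, ← hpow, ← hpow, t.lie_h_pow_toEnd_f_of_eq_smul hv, sub_sub, ← add_smul]
    congr 2
    push_cast
    ring

lemma HasPrimitiveVectorWith.exists_nat_of_pow_eq_zero {t : IsSl2Triple h e f} {v : V} {μ : K}
    (P : t.HasPrimitiveVectorWith v μ) (hf : ∃ k : ℕ, (toEnd K L V f ^ k) v = 0) :
    ∃ n : ℕ, μ = n := by
  obtain ⟨n, hn₁, hn₂⟩ := Nat.exists_not_and_succ_of_not_zero_of_exists P.ne_zero hf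
  refine ⟨n, ?_⟩
  have := P.lie_e_pow_succ_toEnd_f n
  rw [hn₂, lie_zero, eq_comm, smul_eq_zero_iff_left hn₁, mul_eq_zero, sub_eq_zero] at this
  exact this.resolve_left <| Nat.cast_add_one_ne_zero n

/-- The eigenvalues of `h` on a module on which `e` and `f` act locally nilpotently are integers. -/
lemma exists_int_of_locallyNilpotent (t : IsSl2Triple h e f)
    (he : ∀ v : V, ∃ k : ℕ, (toEnd K L V e ^ k) v = 0)
    (hf : ∀ v : V, ∃ k : ℕ, (toEnd K L V f ^ k) v = 0)
    {v : V} (hv₀ : v ≠ 0) {μ : K} (hv : ⁅h, v⁆ = μ • v) : ∃ n : ℤ, μ = n := by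
  obtain ⟨k, hk₁, hk₂⟩ := Nat.exists_not_and_succ_of_not_zero_of_exists hv₀ (he v)
  -- The last nonzero `e ^ k v` is primitive.
  have P : t.HasPrimitiveVectorWith ((toEnd K L V e ^ k) v) (μ + 2 * k) :=
    { ne_zero := hk₁
      lie_h := t.lie_h_pow_toEnd_e hv k
      lie_e := by rwa [lie_e_pow_toEnd_e] }
  obtain ⟨n, hn⟩ := P.exists_nat_of_pow_eq_zero (hf _)
  exact ⟨n - 2 * k, by push_cast; rw [← hn]; ring⟩

/-- Induction on `k` reduces to `e v = 0`, where `f ^ j v ≠ 0` for `j ≤ m` unless `v = 0`. Allowing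
`j ≤ m` rather than `j = m` lets the induction pass to `e v`, of weight `m + 2` and killed by `f ^
(j + 1)`. -/
lemma eq_zero_of_pow_toEnd_f_eq_zero (t : IsSl2Triple h e f) {k m j : ℕ} {v : V}
    (he : (toEnd K L V e ^ k) v = 0) (hv : ⁅h, v⁆ = (m : K) • v) (hj : j ≤ m)
    (hf : (toEnd K L V f ^ j) v = 0) : v = 0 := by
  induction k generalizing m j v with
  | zero => simpa using he
  | succ k ih =>
    have hev : ⁅e, v⁆ = 0 := by
      refine ih (m := m + 2) (j := j + 1) (by rwa [pow_succ, Module.End.mul_apply] at he) ?_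
        (by omega) ?_
      · simpa using t.lie_h_pow_toEnd_e hv 1
      · rw [t.pow_succ_toEnd_f_lie_e hv, hf, pow_succ', Module.End.mul_apply, hf]
        simp
    by_contra hv₀
    have P : t.HasPrimitiveVectorWith v (m : K) := ⟨hv₀, hv, hev⟩
    exact P.pow_toEnd_f_ne_zero_of_eq_nat rfl hj hf

/-- If `e` and `f` act locally nilpotently, then a finite-dimensional space `W` of vectors of
positive weight which is stable under `e ^ m * f ^ m` lies in every submodule containing `f W`. -/
lemma mem_of_lie_f_mem (t : IsSl2Triple h e f)
    (he : ∀ v : V, ∃ k : ℕ, (toEnd K L V e ^ k) v = 0)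
    (hf : ∀ v : V, ∃ k : ℕ, (toEnd K L V f ^ k) v = 0)
    {m : ℕ} (hm : 0 < m) (W : Submodule K V) [FiniteDimensional K W]
    (hW : ∀ v ∈ W, ⁅h, v⁆ = (m : K) • v)
    (hef : ∀ v ∈ W, (toEnd K L V e ^ m) ((toEnd K L V f ^ m) v) ∈ W)
    (M : LieSubmodule K L V) (hM : ∀ v ∈ W, ⁅f, v⁆ ∈ M) {v : V} (hv : v ∈ W) : v ∈ M := by
  have hpow (x : L) (n : ℕ) {u : V} (hu : u ∈ M) : (toEnd K L V x ^ n) u ∈ M := by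
    induction n with
    | zero => simpa using hu
    | succ n ih =>
      rw [pow_succ', Module.End.mul_apply]
      exact M.lie_mem ih
  let φ : W →ₗ[K] W := ((toEnd K L V e ^ m) ∘ₗ (toEnd K L V f ^ m)).restrict hef
  have hφ : Function.Injective φ := by
    rw [← LinearMap.ker_eq_bot, LinearMap.ker_eq_bot']
    rintro ⟨u, hu⟩ h0
    replace h0 : (toEnd K L V e ^ m) ((toEnd K L V f ^ m) u) = 0 := congrArg Subtype.val h0
    obtain ⟨k, hk⟩ := hf ((toEnd K L V f ^ m) u)
    obtain ⟨k', hk'⟩ := he u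
    have hfu : (toEnd K L V f ^ m) u = 0 := by
      -- `f ^ m u` has weight `-m`, hence weight `m` for the opposite triple, in which `e` lowers.
      refine t.symm.eq_zero_of_pow_toEnd_f_eq_zero hk (m := m) ?_ le_rfl h0
      rw [neg_lie, t.lie_h_pow_toEnd_f_of_eq_smul (hW u hu), ← neg_smul]
      congr 1
      ring
    exact Subtype.ext (t.eq_zero_of_pow_toEnd_f_eq_zero hk' (hW u hu) le_rfl hfu)
  obtain ⟨⟨w, hw⟩, hwv⟩ := (LinearMap.injective_iff_surjective.1 hφ) ⟨v, hv⟩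
  replace hwv : (toEnd K L V e ^ m) ((toEnd K L V f ^ m) w) = v := congrArg Subtype.val hwv
  rw [← hwv]
  obtain ⟨m, rfl⟩ := Nat.exists_eq_add_one.2 hm
  rw [pow_succ (toEnd K L V f), Module.End.mul_apply]
  exact hpow e _ (hpow f m (hM w hw))

end

end IsSl2Triple

/-! ### Integral weights and the root form -/

namespace RootPairing

variable {ι M N : Type*} [AddCommGroup M] [Module ℂ M] [AddCommGroup N] [Module ℂ N]
  (P : RootPairing ι ℂ M N)

/-- An element of the weight space of a root pairing is integral if it pairs to integers with all
coroots. -/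
def IsIntegral (x : M) : Prop := ∀ i, ∃ n : ℤ, P.coroot' i x = n

/-- The coroots span, so a weight is determined by its finitely many pairings. -/
lemma finite_setOf_coroot'_mem [Finite ι] [P.IsRootSystem] {T : Set ℂ} (hT : T.Finite) :
    {x : M | ∀ i, P.coroot' i x ∈ T}.Finite := by
  have hinj : Function.Injective fun (x : M) i ↦ P.coroot' i x := by
    intro x y hxy
    refine P.toPerfPair.injective (LinearMap.ext_on_range
      (v := P.coroot) IsRootSystem.span_coroot_eq_top ?_)
    exact fun i ↦ congrFun hxy i
  refine Set.Finite.of_finite_image (f := fun (x : M) i ↦ P.coroot' i x) ?_ hinj.injOn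
  refine (Set.Finite.pi' fun _ : ι ↦ hT).subset ?_
  rintro _ ⟨x, hx, rfl⟩
  exact hx

lemma coroot'_reflectionPerm_self_apply (i : ι) (x : M) :
    P.coroot' (P.reflectionPerm i i) x = -P.coroot' i x := by
  rw [← coroot'_reflection, reflection_apply, map_sub, map_smul, coroot', LinearMap.flip_apply,
    LinearMap.flip_apply, root_coroot_two, smul_eq_mul]
  ring

variable [Fintype ι]

lemma rootForm_sub_root_self (x : M) (i : ι) :
    P.RootForm (x - P.root i) (x - P.root i) =
      P.RootForm x x - (P.coroot' i x - 1) * P.RootForm (P.root i) (P.root i) := by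
  have h1 : 2 * P.RootForm (P.root i) x = P.RootForm (P.root i) (P.root i) * P.coroot' i x := by
    have := congrArg (P.toLinearMap x) (P.rootForm_self_smul_coroot i)
    rw [map_smul, map_nsmul, P.toLinearMap_apply_apply_Polarization] at this
    simpa [two_mul, two_smul] using this.symm
  have h2 : P.RootForm x (P.root i) = P.RootForm (P.root i) x := P.rootForm_symmetric.eq _ _
  simp only [map_sub, LinearMap.sub_apply, h2]
  linear_combination -h1

-- The root form is the sum of the squares of the coroot pairings.
variable {P} in
lemma IsIntegral.rootForm_self_re_nonneg {x : M} (hx : P.IsIntegral x) :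
    0 ≤ (P.RootForm x x).re := by
  rw [rootForm_apply_apply, Complex.re_sum]
  refine Finset.sum_nonneg fun i _ ↦ ?_
  obtain ⟨n, hn⟩ := hx i
  rw [hn, ← Int.cast_mul, Complex.intCast_re]
  exact_mod_cast mul_self_nonneg n

lemma one_le_rootForm_root_self_re [P.IsCrystallographic] (i : ι) :
    1 ≤ (P.RootForm (P.root i) (P.root i)).re := by
  rw [rootForm_root_self, Complex.re_sum]
  have hnonneg (j : ι) : 0 ≤ (P.pairing i j * P.pairing i j).re := by
    obtain ⟨n, hn⟩ := P.exists_value (S := ℤ) i j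
    rw [← hn, algebraMap_int_eq, eq_intCast, ← Int.cast_mul, Complex.intCast_re]
    exact_mod_cast mul_self_nonneg n
  -- The term of the root with itself is already `2 * 2`.
  refine le_trans ?_ (Finset.single_le_sum (fun j _ ↦ hnonneg j) (Finset.mem_univ i))
  norm_num

lemma rootForm_sub_root_self_re_add_one_le [P.IsCrystallographic] {x : M} {i : ι} {n : ℕ}
    (hn : 2 ≤ n) (hx : P.coroot' i x = n) :
    (P.RootForm (x - P.root i) (x - P.root i)).re + 1 ≤ (P.RootForm x x).re := by
  rw [rootForm_sub_root_self, hx]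
  have h1 := P.one_le_rootForm_root_self_re i
  have h2 : (2 : ℝ) ≤ n := by exact_mod_cast hn
  have h3 : (((n : ℂ) - 1) * P.RootForm (P.root i) (P.root i)).re =
      ((n : ℝ) - 1) * (P.RootForm (P.root i) (P.root i)).re := by
    rw [show ((n : ℂ) - 1) = (((n : ℝ) - 1 : ℝ) : ℂ) by push_cast; rfl, Complex.re_ofReal_mul]
  rw [Complex.sub_re, h3]
  nlinarith

end RootPairing

/-! ### Root vectors shift weights -/

namespace LieModule

variable {K L V : Type*} [Field K] [LieRing L] [LieAlgebra K L] {H : LieSubalgebra K L}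
  [AddCommGroup V] [Module K V] [LieRingModule L V] [LieModule K L V]

lemma lie_mem_weightSpace_add {α χ : H → K} {x : L} {v : V} (hx : x ∈ weightSpace L α)
    (hv : v ∈ weightSpace V χ) : ⁅x, v⁆ ∈ weightSpace V (χ + α) := by
  rw [mem_weightSpace] at hx hv ⊢
  intro y
  have hx' : ⁅(y : L), x⁆ = α y • x := hx y
  have hv' : ⁅(y : L), v⁆ = χ y • v := hv y
  rw [LieSubalgebra.coe_bracket_of_module, leibniz_lie, hx', hv', smul_lie, lie_smul, ← add_smul,
    Pi.add_apply, add_comm]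

lemma toEnd_pow_mem_weightSpace {α χ : H → K} {x : L} {v : V} (hx : x ∈ weightSpace L α)
    (hv : v ∈ weightSpace V χ) (n : ℕ) :
    (toEnd K L V x ^ n) v ∈ weightSpace V (χ + n • α) := by
  induction n with
  | zero => simpa using hv
  | succ n ih =>
    rw [pow_succ', Module.End.mul_apply, toEnd_apply_apply, succ_nsmul, ← add_assoc]
    exact lie_mem_weightSpace_add hx ih

end LieModule

/-! ### Integrable modules -/

namespace IsIntegrableModule

open LieModule LieAlgebra LieAlgebra.IsKilling

variable {L V : Type*} [LieRing L] [LieAlgebra ℂ L] [FiniteDimensional ℂ L] [IsKilling ℂ L]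
  {H : LieSubalgebra ℂ L} [H.IsCartanSubalgebra]
  [AddCommGroup V] [Module ℂ V] [LieRingModule L V] [LieModule ℂ L V]

lemma exists_isSl2Triple (hV : IsIntegrableModule H V) (α : H.root) :
    ∃ e f : L, IsSl2Triple (coroot α.1 : L) e f ∧ e ∈ weightSpace L (α.1 : H → ℂ) ∧
      f ∈ weightSpace L (-(α.1 : H → ℂ)) ∧
      (∀ v : V, ∃ k : ℕ, (toEnd ℂ L V e ^ k) v = 0) ∧
      (∀ v : V, ∃ k : ℕ, (toEnd ℂ L V f ^ k) v = 0) := by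
  have hα : α.1.IsNonZero := H.isNonZero_coe_root α
  have hα' : α.1.toLinear ≠ 0 := by simp
  obtain ⟨h, e, f, t, he, hf⟩ := exists_isSl2Triple_of_weight_isNonZero hα
  obtain rfl := t.h_eq_coroot hα he hf
  have he' : e ∈ weightSpace L (α.1 : H → ℂ) :=
    (mem_weightSpace _ _).2 fun y ↦ lie_eq_smul_of_mem_rootSpace he y
  have hf' : f ∈ weightSpace L (-(α.1 : H → ℂ)) :=
    (mem_weightSpace _ _).2 fun y ↦ lie_eq_smul_of_mem_rootSpace hf y
  exact ⟨e, f, t, he', hf', hV.locallyNilpotent α.1.toLinear hα' e he',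
    hV.locallyNilpotent (-α.1.toLinear) (neg_ne_zero.2 hα') f hf'⟩

omit [FiniteDimensional ℂ L] [IsKilling ℂ L] [H.IsCartanSubalgebra] in
lemma iSup_weightSpace_eq_top (hV : IsIntegrableModule H V) :
    ⨆ χ : Module.Dual ℂ H, (weightSpace V (χ : H → ℂ)).toSubmodule = ⊤ := by
  classical
  exact hV.isInternal_weightSpace.submodule_iSup_eq_top

/-- The weights of an integrable module are integral. -/
lemma isIntegral (hV : IsIntegrableModule H V) {χ : Module.Dual ℂ H}
    (hχ : weightSpace V (χ : H → ℂ) ≠ ⊥) : (rootSystem H).IsIntegral χ := by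
  intro α
  obtain ⟨v, hv, hv₀⟩ := (Submodule.ne_bot_iff _).1 ((LieSubmodule.toSubmodule_eq_bot _).not.2 hχ)
  obtain ⟨e, f, t, -, -, he, hf⟩ := hV.exists_isSl2Triple α
  exact t.exists_int_of_locallyNilpotent he hf hv₀ ((mem_weightSpace _ _).1 hv (coroot α.1))

lemma weightSpace_le_of_sub_root (hV : IsIntegrableModule H V) {χ : Module.Dual ℂ H} (α : H.root)
    {n : ℕ} (hn : 0 < n) (hχ : (rootSystem H).coroot' α χ = n) (M : LieSubmodule ℂ L V)
    (hM : (weightSpace V ((χ - (rootSystem H).root α : Module.Dual ℂ H) : H → ℂ)).toSubmodule ≤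
      M.toSubmodule) :
    (weightSpace V (χ : H → ℂ)).toSubmodule ≤ M.toSubmodule := by
  obtain ⟨e, f, t, he, hf, he', hf'⟩ := hV.exists_isSl2Triple α
  have := hV.finite_weightSpace χ
  refine fun v hv ↦ t.mem_of_lie_f_mem he' hf' hn (weightSpace V (χ : H → ℂ)).toSubmodule
    (fun u hu ↦ ?_) (fun u hu ↦ ?_) M (fun u hu ↦ hM ?_) hv
  · rw [← hχ]
    exact (mem_weightSpace _ _).1 hu (coroot α.1)
  · have h := toEnd_pow_mem_weightSpace he (toEnd_pow_mem_weightSpace hf hu n) n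
    rwa [smul_neg, neg_add_cancel_right] at h
  · have h := lie_mem_weightSpace_add hf hu
    rwa [← sub_eq_add_neg] at h

lemma weightSpace_le (hV : IsIntegrableModule H V) (M : LieSubmodule ℂ L V)
    (hM : ∀ χ : Module.Dual ℂ H, (∀ α, (rootSystem H).coroot' α χ ∈ ({-1, 0, 1} : Set ℂ)) →
      (weightSpace V (χ : H → ℂ)).toSubmodule ≤ M.toSubmodule) (χ : Module.Dual ℂ H) :
    (weightSpace V (χ : H → ℂ)).toSubmodule ≤ M.toSubmodule := by
  -- Descent on a natural bound for the form: each subtraction of a root lowers it by at least 1,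
  -- and it is nonnegative on actual weights.
  obtain ⟨n, hn⟩ := exists_nat_gt ((rootSystem H).RootForm χ χ).re
  induction n generalizing χ with
  | zero =>
    by_cases hχ : weightSpace V (χ : H → ℂ) = ⊥
    · simp [hχ]
    · have := (hV.isIntegral hχ).rootForm_self_re_nonneg
      rw [Nat.cast_zero] at hn
      exact absurd hn this.not_gt
  | succ n ih =>
    by_cases hχ : weightSpace V (χ : H → ℂ) = ⊥
    · simp [hχ]
    have key (α : H.root) (m : ℕ) (hm : 2 ≤ m) (hmχ : (rootSystem H).coroot' α χ = m) :
        (weightSpace V (χ : H → ℂ)).toSubmodule ≤ M.toSubmodule := by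
      refine hV.weightSpace_le_of_sub_root α (by omega) hmχ M (ih _ ?_)
      have := (rootSystem H).rootForm_sub_root_self_re_add_one_le hm hmχ
      push_cast at hn
      linarith
    by_cases hS : ∀ α, (rootSystem H).coroot' α χ ∈ ({-1, 0, 1} : Set ℂ)
    · exact hM χ hS
    obtain ⟨α, hα⟩ := not_forall.1 hS
    obtain ⟨z, hz⟩ := hV.isIntegral hχ α
    have hz' : z ≠ -1 ∧ z ≠ 0 ∧ z ≠ 1 := by
      refine ⟨?_, ?_, ?_⟩ <;> rintro rfl <;> exact hα (by simp [hz])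
    obtain hz2 | hz2 : 2 ≤ z ∨ z ≤ -2 := by omega
    · lift z to ℕ using by omega
      exact key α z (by omega) (by simpa using hz)
    -- A pairing `≤ -2` with `α` is a pairing `≥ 2` with `-α`, the reflection of `α` in itself.
    · refine key ((rootSystem H).reflectionPerm α α) z.natAbs (by omega) ?_
      have : ((z.natAbs : ℤ) : ℂ) = -z := by
        rw [Int.ofNat_natAbs_of_nonpos (by omega)]; simp
      rw [Int.cast_natCast] at this
      rw [this, ← hz, RootPairing.coroot'_reflectionPerm_self_apply]

omit [FiniteDimensional ℂ L] [IsKilling ℂ L] [H.IsCartanSubalgebra] in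
lemma isLocallyFiniteElement_of_mem_cartan (hV : IsIntegrableModule H V) (y : H) :
    IsLocallyFiniteElement ℂ V (y : L) := by
  have := hV.finite_weightSpace
  refine isLocallyFiniteElement_of_iSup_eq_top _ hV.iSup_weightSpace_eq_top fun χ v hv ↦ ?_
  have h : ⁅(y : L), v⁆ = χ y • v := (mem_weightSpace _ _).1 hv y
  rw [h]
  exact Submodule.smul_mem _ _ hv

/-- An integrable module is locally finite. -/
lemma exists_lieSubmodule (hV : IsIntegrableModule H V) (U : Submodule ℂ V)
    [FiniteDimensional ℂ U] :
    ∃ M : LieSubmodule ℂ L V, FiniteDimensional ℂ M ∧ U ≤ M.toSubmodule := by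
  have htop : Submodule.span ℂ {x : L | IsLocallyFiniteElement ℂ V x} = ⊤ := by
    have h := congrArg LieSubmodule.toSubmodule (cartan_sup_iSup_rootSpace_eq_top (K := ℂ) (H := H))
    rw [LieSubmodule.top_toSubmodule] at h
    rw [eq_top_iff, ← h]
    simp only [LieSubmodule.sup_toSubmodule, LieSubmodule.iSup_toSubmodule, sup_le_iff, iSup_le_iff]
    refine ⟨fun x hx ↦ Submodule.subset_span ?_, fun α hα x hx ↦ Submodule.subset_span ?_⟩
    · exact hV.isLocallyFiniteElement_of_mem_cartan ⟨x, hx⟩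
    · refine isLocallyFiniteElement_of_pow_eq_zero (hV.locallyNilpotent α.toLinear ?_ x ?_)
      · simpa using hα
      · exact (mem_weightSpace _ _).2 fun y ↦ lie_eq_smul_of_mem_rootSpace hx y
  obtain ⟨s, hs, hspan⟩ := (Submodule.fg_span_iff_fg_span_finset_subset _).1
    (htop ▸ Module.Finite.fg_top)
  refine exists_finiteDimensional_lieSubmodule (x := fun i ↦ (s.equivFin.symm i : L)) ?_
    (fun i ↦ hs (s.equivFin.symm i).2) U
  rw [← htop, hspan]
  congr 1
  rw [← Function.comp_def, s.equivFin.symm.surjective.range_comp]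
  simp

end IsIntegrableModule

theorem lemma3p6 {L : Type*} [LieRing L] [LieAlgebra ℂ L] [FiniteDimensional ℂ L]
    [LieAlgebra.HasTrivialRadical ℂ L] (H : LieSubalgebra ℂ L) [H.IsCartanSubalgebra]
    {V : Type*} [AddCommGroup V] [Module ℂ V] [LieRingModule L V] [LieModule ℂ L V]
    (hV : IsIntegrableModule H V) :
    FiniteDimensional ℂ V := by
  have hS := (LieAlgebra.IsKilling.rootSystem H).finite_setOf_coroot'_mem
    (T := {-1, 0, 1}) (Set.toFinite _)
  set S := {χ : Module.Dual ℂ H |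
    ∀ α, (LieAlgebra.IsKilling.rootSystem H).coroot' α χ ∈ ({-1, 0, 1} : Set ℂ)}
  have := hS.to_subtype
  have := hV.finite_weightSpace
  obtain ⟨M, hM, hUM⟩ := hV.exists_lieSubmodule
    (⨆ χ : S, (LieModule.weightSpace V (χ.1 : H → ℂ)).toSubmodule)
  have hle := hV.weightSpace_le M fun χ hχ ↦
    (le_iSup (fun χ : S ↦ (LieModule.weightSpace V (χ.1 : H → ℂ)).toSubmodule) ⟨χ, hχ⟩).trans hUM
  have htop : M.toSubmodule = ⊤ := by
    rw [eq_top_iff, ← hV.iSup_weightSpace_eq_top]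
    exact iSup_le hle
  exact Module.finite_def.2 (htop ▸ Module.Finite.iff_fg.1 hM)
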